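/- Let $A,B\in\mathbb C[x]$ with $A\neq 0$, $\deg A\le 2$, $\deg B=1$, let $\mathcal L=A\,\partial^2+B\,\partial$, and let $P_n$ ($n\ge 0$) be polynomials with $\deg P_n=n$ and $\mathcal L P_n=\lambda_nP_n$. For a closed curve $\gamma$ on the Riemann sphere that avoids $x$ and the poles of the integrand, put $$\eta(x;A,B,\gamma)=\frac1{2\pi i}\oint_\gamma\frac{B(z)-A'(z)}{A(z)}\,\frac{dz}{z-x}.$$ Poles are those of the integrand as a differential form on $\mathbb C\cup\{\infty\}$. Let $\rho$ be one of the following types. Type III: the curve, positively oriented, encloses all the poles except $x$. Types I and II: there are exactly two poles $a_1\ne a_2$ besides $x$ (with $a_1$ finite), and the curve encloses, positively oriented, only $a_1$ (type I) or only $a_2$ (type II). On a nonempty open set $\Omega\subset\mathbb C$ without zeros of $A$ let $\xi_\rho$ be a nowhere vanishing holomorphic function with $\xi_\rho'/\xi_\rho=\eta(x;A,B,\rho)$, and let $A_\rho\ne 0$ be a polynomial with $A_\rho'/A_\rho=\eta(x;A,0,\rho)$ (it is unique up to a constant factor). Let $p_{\rho,n}$ ($n\ge 0$) be polynomials with $\deg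 p_{\rho,n}=n$ and $\mathcal L[\xi_\rho p_{\rho,n}]=\lambda_{\rho,n}\,\xi_\rho p_{\rho,n}$. Assume that the numbers $\lambda_m$, $\lambda_{\rho,n}$ ($m,n\ge 0$) are mutually distinct. Fix $j\ge 0$, let $\phi_{\rho,j}=\xi_\rho p_{\rho,j}$ be the seed function and $\mathcal T[f]=\frac{A_\rho}{\xi_\rho}\bigl(\phi_{\rho,j}f'-\phi_{\rho,j}'f\bigr)$ the Darboux transformation. The $X_j$-polynomials of type $\rho$ are - for $\rho=\mathrm{I},\mathrm{II}$: $\widehat P_n=\mathcal T[P_n]$ for $n\ge 0$; - for $\rho=\mathrm{III}$: $\widehat P_0=1$, $\widehat P_n=\mathcal T[P_{n-j-1}]$ for $n\ge j+1$, and $\widehat P_n=0$ for $1\le n\le j$; and $\widehat P_n=0$ for $n<0$. Let $I_j$ be any antiderivative of $p_{\rho,j}$, a polynomial of degree $j+1$. Then every $\widehat P_n$ is a polynomial, of degree $n+j$ for $\rho=\mathrm{I},\mathrm{II}$ ($n\ge0$) and of degree $n$ for $\rho=\mathrm{III}$ ($n=0$ or $n\ge j+1$), and there are constants $\beta_{n,l}\in\mathbb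 C$ such that for every $n$ with $\widehat P_n\ne 0$ $$I_j(x)\,\widehat P_n(x)=\sum_{l=-j-1}^{j+1}\beta_{n,l}\,\widehat P_{n+l}(x).$$ -/

import Mathlib

open Polynomial Filter Topology

noncomputable section

namespace XOP

/-- The operator `A ∂² + B ∂` on functions of a complex variable. -/
def opL (A B : ℂ[X]) (f : ℂ → ℂ) (x : ℂ) : ℂ :=
  A.eval x * deriv (deriv f) x + B.eval x * deriv f x

/-- `(2πi)⁻¹ ∮_γ f(z) dz`, where `γ` is a closed curve on the Riemann sphere that encloses the point
`ζ` and no other singularity of `f`, positively oriented as seen from `ζ`: a small circle about `ζ`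
when `ζ` is finite, a large circle run clockwise when `ζ = ∞`. The integral does not depend on the
radius as soon as the circle isolates `ζ`, and is written as the limit over the radius. -/
def loopIntegral (f : ℂ → ℂ) : OnePoint ℂ → ℂ
  | some a => limUnder (𝓝[>] (0 : ℝ)) fun r =>
      (2 * (Real.pi : ℂ) * Complex.I)⁻¹ * ∮ z in C(a, r), f z
  | none => limUnder (atTop : Filter ℝ) fun R =>
      -((2 * (Real.pi : ℂ) * Complex.I)⁻¹ * ∮ z in C((0 : ℂ), R), f z)

/-- The integrand `(B(z) - A'(z)) / (A(z) (z - x))`. -/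
def integrand (A B : ℂ[X]) (x z : ℂ) : ℂ :=
  (B.eval z - (derivative A).eval z) / A.eval z * (1 / (z - x))

/-- `ζ` is a pole, other than `x`, of the differential form `(B - A') / (A (z - x)) dz` on the
Riemann sphere. At infinity the form behaves like `z ^ (deg (B - A') - deg A - 1) dz`, which has
a pole there exactly when that exponent is at least `-1`. -/
def IsPole (A B : ℂ[X]) : OnePoint ℂ → Prop
  | some a => B - derivative A ≠ 0 ∧
      (B - derivative A).rootMultiplicity a < A.rootMultiplicity a
  | none => B - derivative A ≠ 0 ∧ A.degree ≤ (B - derivative A).degree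

/-- The nontrivial closed curves that determine a gauge factor. The curve `I a₁ a₂` encloses `a₁` but
neither `a₂` nor `x`, the curve `II a₁ a₂` encloses `a₂` but neither `a₁` nor `x`, and the
curve `III` encloses all the poles except `x`. -/
inductive Curve
  | I (a₁ a₂ : OnePoint ℂ)
  | II (a₁ a₂ : OnePoint ℂ)
  | III

/-- The curves `I` and `II` exist only if there are exactly two poles `a₁ ≠ a₂` besides `x`; at most
one of them is infinite, and `a₁` denotes a finite one. -/
def Curve.Exists (A B : ℂ[X]) : Curve → Prop
  | .I a₁ a₂ => a₁ ≠ OnePoint.infty ∧ a₁ ≠ a₂ ∧ {ζ | IsPole A B ζ} = {a₁, a₂}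
  | .II a₁ a₂ => a₁ ≠ OnePoint.infty ∧ a₁ ≠ a₂ ∧ {ζ | IsPole A B ζ} = {a₁, a₂}
  | .III => True

/-- `η(x; A, B, γ) = (2πi)⁻¹ ∮_γ (B(z) - A'(z)) / A(z) · dz / (z - x)`. On the sphere, a positively
oriented curve that encloses every pole except `x` is a small circle about `x` run clockwise. -/
def eta (A B : ℂ[X]) (γ : Curve) (x : ℂ) : ℂ :=
  match γ with
  | .I a₁ _ => loopIntegral (integrand A B x) a₁
  | .II _ a₂ => loopIntegral (integrand A B x) a₂
  | .III => -loopIntegral (integrand A B x) (x : OnePoint ℂ)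

/-- `ξ` is a gauge factor `exp (∫ η(x; A, B, γ) dx)` on `Ω`. -/
def IsGauge (A B : ℂ[X]) (γ : Curve) (Ω : Set ℂ) (ξ : ℂ → ℂ) : Prop :=
  ∀ x ∈ Ω, ξ x ≠ 0 ∧ HasDerivAt ξ (eta A B γ x * ξ x) x

/-- `G` is the polynomial `A_γ`, determined up to a nonzero constant factor
by `A_γ' / A_γ = η(x; A, 0, γ)`. -/
def IsGaugePart (A : ℂ[X]) (γ : Curve) (G : ℂ[X]) : Prop :=
  G ≠ 0 ∧ ∀ x, A.eval x ≠ 0 → (derivative G).eval x = eta A 0 γ x * G.eval x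

/-- The quasi-polynomial `φ = ξ p`. -/
def quasi (ξ : ℂ → ℂ) (p : ℂ[X]) (x : ℂ) : ℂ := ξ x * p.eval x

/-- The Darboux transform `(G / ξ) Wr[φ, f]` of `f` with seed `φ`,
where `Wr[φ, f] = φ f' - φ' f`. -/
def darboux (G : ℂ[X]) (ξ φ f : ℂ → ℂ) (x : ℂ) : ℂ :=
  G.eval x / ξ x * (φ x * deriv f x - deriv φ x * f x)

/-- The `n`-th exceptional polynomial, as a function, built from the Darboux transforms `T m` of the
classical polynomials `P m`: for the types I and II it is `T n`; for type III it is `1` for `n = 0`,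
it is `T (n - j - 1)` for `n ≥ j + 1`, and `0` otherwise. It is `0` for `n < 0`. -/
def xop (γ : Curve) (j : ℕ) (T : ℕ → ℂ → ℂ) (n : ℤ) (x : ℂ) : ℂ :=
  match γ with
  | .III => if n = 0 then 1 else if (j : ℤ) + 1 ≤ n then T (n - j - 1).toNat x else 0
  | _ => if 0 ≤ n then T n.toNat x else 0

/-- The degree of the `n`-th exceptional polynomial: `n + j` for the types I and II, `n` for type III,
where the indices `1, …, j` are missing. -/
def HasXOPDegrees (γ : Curve) (j : ℕ) (Q : ℤ → ℂ[X]) : Prop :=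
  match γ with
  | .III => ∀ n : ℕ, n = 0 ∨ j + 1 ≤ n → (Q n).degree = (n : ℕ)
  | _ => ∀ n : ℕ, (Q n).degree = ((n + j : ℕ) : WithBot ℕ)

end XOP

end

noncomputable section

namespace XOP

/-! Let `L = A ∂² + B ∂`, `K = A_ρ`, `A = K J` and `η = E / K`. After removal of `ξ`, the Darboux
transformation becomes the polynomial operator `T = raise K E p`, and with `S = lower J m` it
satisfies `S T = p (L - μ)`, where `μ` is the eigenvalue of the seed (`lower_raise`). Since `I' =
p`, this gives `S (I T f) = p (I (L - μ) f + J T f)` (`lower_mul_raise`). For `f = P n` the bracket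
lies in the span of the `P k` with `|k - n| ≤ j + 1`: multiplication by `X` is tridiagonal on the `P
k` (`X_mul_mem_band_one`), and `A p ∂` is half the commutator of `L` with `I` up to a multiplication
operator (`mul_derivative_mem_band`). As `μ` is none of the `lam k`, `L - μ` can be inverted inside
this span, which yields `g` with `S (I T (P n) - T g) = 0` (`exists_lower_eq_zero`). For types I and
II, `S` is injective and the recurrence follows. For type III, `S = c ∂` kills the constants, that
is, the multiples of the exceptional polynomial of index `0`, which lies in the window of `T (P n)`
only for `n = 0`. For `n ≥ 1` the eigenvalue is nonzero and an explicit preimage leaves no constant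
(`mul_raise_of_eigen`); at index `0`, `I` is an affine function of `T 1` (`antiderivative_eq`). The
degrees come from comparing top coefficients in `S T f = p (L - μ) f`. -/

/-- The operator `A ∂² + B ∂` on polynomials. -/
def hyper (A B : ℂ[X]) : ℂ[X] →ₗ[ℂ] ℂ[X] :=
  LinearMap.mulLeft ℂ A ∘ₗ derivative ∘ₗ derivative + LinearMap.mulLeft ℂ B ∘ₗ derivative

@[simp]
lemma hyper_apply (A B f : ℂ[X]) :
    hyper A B f = A * derivative (derivative f) + B * derivative f := rfl

/-- The polynomial form `K (p f' - p' f) - E p f` of the Darboux transformation. -/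
def raise (K E p : ℂ[X]) : ℂ[X] →ₗ[ℂ] ℂ[X] :=
  LinearMap.mulLeft ℂ (K * p) ∘ₗ derivative - LinearMap.mulLeft ℂ (K * derivative p + E * p)

@[simp]
lemma raise_apply (K E p f : ℂ[X]) :
    raise K E p f = K * p * derivative f - (K * derivative p + E * p) * f := rfl

/-- The first-order operator `J ∂ + m`. -/
def lower (J : ℂ[X]) (m : ℂ) : ℂ[X] →ₗ[ℂ] ℂ[X] :=
  LinearMap.mulLeft ℂ J ∘ₗ derivative + LinearMap.mulLeft ℂ (C m)

@[simp]
lemma lower_apply (J : ℂ[X]) (m : ℂ) (y : ℂ[X]) : lower J m y = J * derivative y + C m * y := rfl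

/-- The operator `A ∂² + B ∂` admits a gauge factor `ξ` with `ξ' / ξ = E / K`. -/
structure Gauged (A B K J E : ℂ[X]) (m : ℂ) : Prop where
  mul_eq : A = K * J
  gauge_eq : J * E + B - J * derivative K = C m * K

/-! ### Factorization of the operator through the Darboux transformation. -/

section Factorization

variable {A B K J E p : ℂ[X]} {m mu : ℂ}

/-- The `p' f'` terms cancel, the gauge equation turns the coefficient of `p f'` into `B`, and the
seed equation `hp` settles the terms in `f`. -/
lemma lower_raise (h : Gauged A B K J E m)
    (hp : lower J m (E * p + K * derivative p) = C mu * p) (f : ℂ[X]) :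
    lower J m (raise K E p f) = p * (hyper A B f - C mu * f) := by
  obtain ⟨rfl, h2⟩ := h
  simp only [lower_apply, raise_apply, hyper_apply, derivative_add, derivative_sub,
    derivative_mul] at hp ⊢
  linear_combination (-f) * hp - p * derivative f * h2

lemma lower_mul_raise (h : Gauged A B K J E m)
    (hp : lower J m (E * p + K * derivative p) = C mu * p) {I : ℂ[X]} (hI : derivative I = p)
    (f : ℂ[X]) :
    lower J m (I * raise K E p f) =
      p * (I * (hyper A B f - C mu * f) + J * raise K E p f) := by
  have := lower_raise h hp f
  rw [lower_apply] at this ⊢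
  rw [derivative_mul, hI]
  linear_combination I * this

/-- `raise (I f) = I raise f + K p² f`, while `raise (p h) = p² (K h' - E h)`, which equals `l K p²
f` for `h = A f'`; the two extra terms cancel. -/
lemma mul_raise_of_eigen {c l : ℂ} (h : Gauged A B K (C c) E 0) {I : ℂ[X]} (hI : derivative I = p)
    {f : ℂ[X]} (hl : l ≠ 0) (hf : hyper A B f = C l * f) :
    I * raise K E p f = raise K E p (I * f - C l⁻¹ * (p * (A * derivative f))) := by
  obtain ⟨rfl, h2⟩ := h
  have hll : (C l⁻¹ * C l : ℂ[X]) = 1 := by rw [← C_mul, inv_mul_cancel₀ hl, C_1]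
  simp only [hyper_apply, raise_apply, derivative_mul, derivative_sub, derivative_C, hI, map_zero,
    zero_mul] at hf h2 ⊢
  linear_combination (K * p ^ 2 * f) * hll + C l⁻¹ * K * p ^ 2 * hf -
    C l⁻¹ * K * p ^ 2 * derivative f * h2

end Factorization

/-! ### An algebraic relation between the operator and multiplication by `X`. -/

section ThreeTerm

variable {A B : ℂ[X]}

/-- The double commutator of `L` with `X` closes up because `deg A ≤ 2` and `deg B ≤ 1`. This
replaces orthogonality in the proof of the three-term recurrence. -/
lemma hyper_hyper_X_mul {a₀ a₁ a₂ b₀ b₁ : ℂ} (hA : A = C a₀ + C a₁ * X + C a₂ * X ^ 2)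
    (hB : B = C b₀ + C b₁ * X) {f : ℂ[X]} {l : ℂ} (hf : hyper A B f = C l * f) :
    hyper A B (hyper A B (X * f)) - C (2 * l) * hyper A B (X * f) + C (l ^ 2) * (X * f)
      - C (2 * a₂) * (hyper A B (X * f) + C l * (X * f)) - C (b₁ * (b₁ - 2 * a₂)) * (X * f)
      = C (2 * l * a₁ + b₀ * (b₁ - 2 * a₂)) * f := by
  have hA' : derivative A = C a₁ + C (2 * a₂) * X := by
    rw [hA]; simp [C_mul, map_ofNat]; ring
  have hA'' : derivative (derivative A) = C (2 * a₂) := by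
    rw [hA']; simp
  have hB' : derivative B = C b₁ := by rw [hB]; simp
  have hf0 : A * derivative (derivative f) + B * derivative f = C l * f := hf
  -- `g` is `(L - l) (X f)`.
  set g := C 2 * A * derivative f + B * f with hg
  have hX : hyper A B (X * f) = C l * (X * f) + g := by
    simp only [hyper_apply, derivative_mul, derivative_add, derivative_X, derivative_one, hg]
    simp only [map_ofNat]
    linear_combination X * hf0
  have hg' : derivative g
      = C 2 * derivative A * derivative f + C (2 * l) * f - B * derivative f + C b₁ * f := by
    simp only [hg, derivative_mul, derivative_add, hB', C_mul, map_ofNat, derivative_ofNat]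
    linear_combination 2 * hf0
  have hg'' : derivative (derivative g) = C (2 * (2 * a₂)) * derivative f
      + C 2 * derivative A * derivative (derivative f) + C (2 * l) * derivative f
      - B * derivative (derivative f) := by
    rw [hg']
    simp only [derivative_mul, derivative_add, derivative_sub, derivative_C, hB', hA'', C_mul,
      map_ofNat, derivative_ofNat]
    ring
  have hLg : hyper A B g - C l * g = C (2 * (2 * a₂)) * A * derivative f
      + (C (2 * l) * derivative A + C b₁ * B) * f := by
    rw [hyper_apply, hg'', hg', hg]
    simp only [C_mul, map_ofNat]
    linear_combination (2 * derivative A - B) * hf0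
  have hLX : hyper A B (C l * (X * f)) = C l * hyper A B (X * f) := by
    rw [← smul_eq_C_mul, map_smul, smul_eq_C_mul]
  rw [hX, map_add, hLX, hX]
  rw [hA'] at hLg
  simp only [C_mul, C_add, C_sub, C_pow, map_ofNat] at hLg hg ⊢
  linear_combination hLg - 2 * C a₂ * hg + (C b₁ - 2 * C a₂) * f * hB

end ThreeTerm

/-! ### Banded operators in the eigenbasis. -/

section Band

variable {A B : ℂ[X]} {P : ℕ → ℂ[X]} {lam : ℕ → ℂ}

/-- The span of the members of the family `P` with index at distance at most `d` from `n`. -/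
def band (P : ℕ → ℂ[X]) (d n : ℕ) : Submodule ℂ ℂ[X] :=
  Submodule.span ℂ (P '' {k | k ≤ n + d ∧ n ≤ k + d})

/-- A polynomial sequence as a basis. -/
def seqBasis (hPdeg : ∀ n, (P n).degree = (n : ℕ)) : Module.Basis ℕ ℂ ℂ[X] :=
  (⟨P, hPdeg⟩ : Polynomial.Sequence ℂ).basis fun i =>
    isUnit_iff_ne_zero.2 (leadingCoeff_ne_zero.2 ((⟨P, hPdeg⟩ : Polynomial.Sequence ℂ).ne_zero i))

@[simp]
lemma seqBasis_apply (hPdeg : ∀ n, (P n).degree = (n : ℕ)) (n : ℕ) : seqBasis hPdeg n = P n :=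
  Polynomial.Sequence.basis_eq_self _ _ _

lemma repr_hyper (hPdeg : ∀ n, (P n).degree = (n : ℕ))
    (hP : ∀ n, hyper A B (P n) = C (lam n) * P n) (f : ℂ[X]) (k : ℕ) :
    (seqBasis hPdeg).repr (hyper A B f) k = lam k * (seqBasis hPdeg).repr f k := by
  let b := seqBasis hPdeg
  have : (b.coord k) ∘ₗ hyper A B = lam k • b.coord k := by
    refine b.ext fun n => ?_
    have h1 : b n = P n := seqBasis_apply hPdeg n
    have h2 : hyper A B (b n) = lam n • b n := by rw [h1, hP, smul_eq_C_mul]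
    rw [LinearMap.comp_apply, h2, map_smul, LinearMap.smul_apply, Module.Basis.coord_apply,
      b.repr_self]
    by_cases hnk : n = k
    · rw [hnk]
    · simp [Finsupp.single_eq_of_ne' hnk]
  exact LinearMap.congr_fun this f

lemma lam_eq {a₀ a₁ a₂ b₀ b₁ : ℂ} (hA : A = C a₀ + C a₁ * X + C a₂ * X ^ 2)
    (hB : B = C b₀ + C b₁ * X) (hPdeg : ∀ n, (P n).degree = (n : ℕ))
    (hP : ∀ n, hyper A B (P n) = C (lam n) * P n) (n : ℕ) :
    lam n = n * ((n - 1) * a₂ + b₁) := by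
  have hd : (P n).natDegree = n := natDegree_eq_of_degree_eq_some (hPdeg n)
  have hlc : (P n).coeff n ≠ 0 := by
    have : (P n).leadingCoeff ≠ 0 := leadingCoeff_ne_zero.2 (by
      intro h; have := hPdeg n; simp [h] at this)
    rwa [leadingCoeff, hd] at this
  have h1 : (P n).coeff (n + 1) = 0 := coeff_eq_zero_of_natDegree_lt (by omega)
  have h2 : (P n).coeff (n + 1 + 1) = 0 := coeff_eq_zero_of_natDegree_lt (by omega)
  have h := congrArg (fun q => coeff q n) (hP n)
  simp only [hyper_apply, hA, hB, add_mul, coeff_add, mul_assoc, coeff_C_mul] at h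
  have e : (X * derivative (P n)).coeff n = n * (P n).coeff n := by
    cases n with
    | zero => simp
    | succ n => rw [coeff_X_mul, coeff_derivative]; push_cast; ring
  have e' : (X * derivative (derivative (P n))).coeff n = 0 := by
    cases n with
    | zero => simp
    | succ n => rw [coeff_X_mul, coeff_derivative, coeff_derivative, h1]; simp
  have e2 : (X ^ 2 * derivative (derivative (P n))).coeff n = n * (n - 1) * (P n).coeff n := by
    rcases n with _ | _ | n
    · simp
    · rw [coeff_X_pow_mul']; simp
    · rw [coeff_X_pow_mul, coeff_derivative, coeff_derivative]; push_cast; ring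
  simp only [e, e', e2, coeff_derivative, h1, h2] at h
  apply mul_right_cancel₀ hlc
  linear_combination -h

lemma mem_band_iff (hPdeg : ∀ n, (P n).degree = (n : ℕ)) {f : ℂ[X]} {d n : ℕ} :
    f ∈ band P d n ↔ ∀ k, (seqBasis hPdeg).repr f k ≠ 0 → k ≤ n + d ∧ n ≤ k + d := by
  have : P = seqBasis hPdeg := by ext1 n; simp
  rw [band]
  nth_rw 1 [this]
  rw [Module.Basis.mem_span_image]
  simp [Set.subset_def]

/-- In the eigenbasis `hyper_hyper_X_mul` becomes one scalar equation per coefficient. For `k ≠ n`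
its right side vanishes, and the scalar factor on the left is zero only for `k = n ± 1`. -/
lemma X_mul_mem_band_one (hA2 : A.natDegree ≤ 2) (hB1 : B.natDegree ≤ 1)
    (hPdeg : ∀ n, (P n).degree = (n : ℕ)) (hP : ∀ n, hyper A B (P n) = C (lam n) * P n)
    (hlam : Function.Injective lam) (n : ℕ) : X * P n ∈ band P 1 n := by
  rw [mem_band_iff hPdeg]
  intro k hk
  obtain ⟨a₀, a₁, a₂, hA⟩ : ∃ a₀ a₁ a₂, A = C a₀ + C a₁ * X + C a₂ * X ^ 2 := by
    refine ⟨A.coeff 0, A.coeff 1, A.coeff 2, ?_⟩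
    conv_lhs => rw [A.as_sum_range_C_mul_X_pow' (n := 3) (by omega)]
    simp [Finset.sum_range_succ]
  obtain ⟨b₀, b₁, hB⟩ : ∃ b₀ b₁, B = C b₀ + C b₁ * X := by
    refine ⟨B.coeff 0, B.coeff 1, ?_⟩
    conv_lhs => rw [B.as_sum_range_C_mul_X_pow' (n := 2) (by omega)]
    simp [Finset.sum_range_succ]
  have hl := lam_eq hA hB hPdeg hP
  -- `lam (i + 1) - lam 0 = (i + 1) (i a₂ + b₁)`, and `lam` is injective.
  have hne : ∀ i : ℕ, (i : ℂ) * a₂ + b₁ ≠ 0 := by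
    intro i hi
    have h1 := hl (i + 1)
    have h0 := hl 0
    have : lam (i + 1) = lam 0 := by
      rw [h1, h0]; push_cast; linear_combination ((i : ℂ) + 1) * hi
    exact absurd (hlam this) (by omega)
  by_contra hcon
  have hkn : n ≠ k := by rintro rfl; omega
  have h := hyper_hyper_X_mul hA hB (hP n)
  generalize 2 * lam n * a₁ + b₀ * (b₁ - 2 * a₂) = c at h
  replace h := congrArg (fun q => (seqBasis hPdeg).repr q k) h
  simp only [← smul_eq_C_mul, map_sub, map_add, map_smul, Finsupp.sub_apply, Finsupp.add_apply,
    Finsupp.smul_apply, repr_hyper hPdeg hP, smul_eq_mul] at h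
  have h0 : (seqBasis hPdeg).repr (P n) k = 0 := by
    conv_lhs => rw [← seqBasis_apply hPdeg n, Module.Basis.repr_self]
    exact Finsupp.single_eq_of_ne' hkn
  rw [h0, mul_zero] at h
  have h' : ((k : ℂ) - n - 1) * ((k : ℂ) - n + 1) * (((k : ℂ) + n - 2) * a₂ + b₁) *
      (((k : ℂ) + n) * a₂ + b₁) = 0 := by
    apply mul_right_cancel₀ hk
    rw [zero_mul, ← h, hl k, hl n]
    ring
  have hkn2 : 2 ≤ k + n := by omega
  have c1 : (k : ℂ) - n - 1 ≠ 0 := by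
    intro hc
    have : (k : ℂ) = (n + 1 : ℕ) := by push_cast; linear_combination hc
    rw [Nat.cast_inj] at this; omega
  have c2 : (k : ℂ) - n + 1 ≠ 0 := by
    intro hc
    have : ((k + 1 : ℕ) : ℂ) = n := by push_cast; linear_combination hc
    rw [Nat.cast_inj] at this; omega
  have c3 : ((k : ℂ) + n - 2) * a₂ + b₁ ≠ 0 := by
    have := hne (k + n - 2)
    rwa [Nat.cast_sub hkn2, Nat.cast_add, Nat.cast_ofNat] at this
  have c4 : ((k : ℂ) + n) * a₂ + b₁ ≠ 0 := by
    have := hne (k + n)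
    rwa [Nat.cast_add] at this
  exact mul_ne_zero (mul_ne_zero (mul_ne_zero c1 c2) c3) c4 h'

lemma band_mono {d d' n n' : ℕ} (h₁ : n' + d' ≤ n + d) (h₂ : n + d' ≤ n' + d) :
    band P d' n' ≤ band P d n :=
  Submodule.span_mono (Set.image_mono fun k hk => by
    simp only [Set.mem_ofPred_eq] at hk ⊢; omega)

lemma mul_mem_band (hX : ∀ n, X * P n ∈ band P 1 n) {q : ℂ[X]} {d : ℕ} (hq : q.natDegree ≤ d)
    (n : ℕ) : q * P n ∈ band P d n := by
  have hpow : ∀ i : ℕ, X ^ i * P n ∈ band P i n := by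
    intro i
    induction i with
    | zero => rw [pow_zero, one_mul]; exact Submodule.subset_span ⟨n, by simp, rfl⟩
    | succ i ih =>
      have hstep : band P i n ≤ (band P (i + 1) n).comap (LinearMap.mulLeft ℂ X) := by
        rw [band, Submodule.span_le]
        rintro _ ⟨k, hk, rfl⟩
        simp only [Set.mem_ofPred_eq] at hk
        exact band_mono (by omega) (by omega) (hX k)
      have := hstep ih
      rwa [Submodule.mem_comap, LinearMap.mulLeft_apply, ← mul_assoc, ← pow_succ'] at this
  rw [q.as_sum_range_C_mul_X_pow, Finset.sum_mul]
  refine Submodule.sum_mem _ fun i hi => ?_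
  rw [mul_assoc, ← smul_eq_C_mul]
  rw [Finset.mem_range] at hi
  exact Submodule.smul_mem _ _ (band_mono (by omega) (by omega) (hpow i))

lemma hyper_mem_band (hP : ∀ n, hyper A B (P n) = C (lam n) * P n) {d n : ℕ} {f : ℂ[X]}
    (hf : f ∈ band P d n) : hyper A B f ∈ band P d n := by
  have : band P d n ≤ (band P d n).comap (hyper A B) := by
    rw [band, Submodule.span_le]
    rintro _ ⟨k, hk, rfl⟩
    rw [SetLike.mem_coe, Submodule.mem_comap, hP, ← smul_eq_C_mul]
    exact Submodule.smul_mem _ _ (Submodule.subset_span ⟨k, hk, rfl⟩)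
  exact this hf

lemma exists_hyper_sub_eq (hP : ∀ n, hyper A B (P n) = C (lam n) * P n) {mu : ℂ}
    (hmu : ∀ n, lam n ≠ mu) {d n : ℕ} {f : ℂ[X]} (hf : f ∈ band P d n) :
    ∃ g ∈ band P d n, hyper A B g - C mu * g = f := by
  have : band P d n ≤ (band P d n).map (hyper A B - LinearMap.mulLeft ℂ (C mu)) := by
    conv_lhs => rw [band]
    rw [Submodule.span_le]
    rintro _ ⟨k, hk, rfl⟩
    refine ⟨(lam k - mu)⁻¹ • P k,
      Submodule.smul_mem _ _ (Submodule.subset_span ⟨k, hk, rfl⟩), ?_⟩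
    rw [map_smul, LinearMap.sub_apply, hP, LinearMap.mulLeft_apply, ← sub_mul, ← C_sub,
      ← smul_eq_C_mul, smul_smul, inv_mul_cancel₀ (sub_ne_zero.2 (hmu k)), one_smul]
  exact this hf

/-- The operator `A q ∂` on the eigenpolynomials, via the commutator of `A ∂² + B ∂` with an
antiderivative of `q`. -/
lemma mul_derivative_mem_band (hA2 : A.natDegree ≤ 2) (hB1 : B.natDegree ≤ 1)
    (hP : ∀ n, hyper A B (P n) = C (lam n) * P n) (hX : ∀ n, X * P n ∈ band P 1 n)
    {I q : ℂ[X]} {j : ℕ} (hI : derivative I = q) (hId : I.natDegree ≤ j + 1)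
    (hq : q.natDegree ≤ j) (n : ℕ) : A * q * derivative (P n) ∈ band P (j + 1) n := by
  -- A constant `q` needs its own case: for `j = 0` the product bound would only give `2`.
  have hq' : (A * derivative q).natDegree ≤ j + 1 := by
    by_cases h0 : derivative q = 0
    · simp [h0]
    have h1 : q.natDegree ≠ 0 := fun h => h0 (derivative_of_natDegree_zero h)
    have h2 := natDegree_derivative_lt h1
    refine natDegree_mul_le.trans ?_
    omega
  have key : A * q * derivative (P n) = (2⁻¹ : ℂ) • (hyper A B (I * P n) - lam n • (I * P n)
      - (A * derivative q + B * q) * P n) := by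
    have h2 : (2 : ℂ[X]) = C 2 := (map_ofNat C 2).symm
    have h3 := hP n
    rw [hyper_apply] at h3
    rw [eq_inv_smul_iff₀ two_ne_zero, smul_eq_C_mul, smul_eq_C_mul, hyper_apply, ← h2]
    simp only [derivative_mul, derivative_add, hI]
    linear_combination -I * h3
  rw [key]
  refine Submodule.smul_mem _ _ (Submodule.sub_mem _ (Submodule.sub_mem _ ?_ ?_) ?_)
  · exact hyper_mem_band hP (mul_mem_band hX hId n)
  · exact Submodule.smul_mem _ _ (mul_mem_band hX hId n)
  · refine mul_mem_band hX ((natDegree_add_le _ _).trans (max_le hq' ?_)) n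
    exact natDegree_mul_le.trans (by omega)

end Band

/-! ### Degrees of the transforms. -/

section Degree

variable {A B K J E I f p q y : ℂ[X]} {m mu l c : ℂ}

lemma natDegree_mul_derivative_le {d k : ℕ} (hq : q.natDegree ≤ d + 1) (hf : f.natDegree ≤ k) :
    (q * derivative f).natDegree ≤ d + k := by
  by_cases h0 : derivative f = 0
  · simp [h0]
  have h1 : f.natDegree ≠ 0 := fun h => h0 (derivative_of_natDegree_zero h)
  have h2 := natDegree_derivative_lt h1
  exact natDegree_mul_le.trans (by omega)

lemma natDegree_raise_le {d k n : ℕ} (hK : K.natDegree ≤ d + 1) (hE : E.natDegree ≤ d)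
    (hp : p.natDegree ≤ n) (hf : f.natDegree ≤ k) : (raise K E p f).natDegree ≤ k + n + d := by
  rw [raise_apply]
  refine (natDegree_sub_le _ _).trans (max_le ?_ ?_)
  · have hKp : (K * p).natDegree ≤ (n + d) + 1 := natDegree_mul_le.trans (by omega)
    exact (natDegree_mul_derivative_le hKp hf).trans (by omega)
  · have h1 := natDegree_mul_derivative_le hK hp
    have h2 : (E * p).natDegree ≤ d + n := natDegree_mul_le.trans (by omega)
    have h3 := (natDegree_add_le _ _).trans (max_le h1 h2)
    exact natDegree_mul_le.trans (by omega)

lemma coeff_lower {k : ℕ} (hJ : J.natDegree ≤ 1) (hy : y.natDegree ≤ k) :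
    (lower J m y).coeff k = (J.coeff 1 * k + m) * y.coeff k := by
  rw [lower_apply, coeff_add, coeff_C_mul, add_mul]
  congr 1
  cases k with
  | zero => rw [derivative_of_natDegree_zero (by omega)]; simp
  | succ k =>
    have h : (derivative y).natDegree ≤ k := (natDegree_derivative_le y).trans (by omega)
    rw [add_comm k, coeff_mul_add_eq_of_natDegree_le hJ h, coeff_derivative, add_comm 1 k]
    push_cast
    ring

lemma coeff_natDegree_ne_zero {n : ℕ} (h : p.degree = n) : p.coeff n ≠ 0 := by
  have h0 : p ≠ 0 := by rintro rfl; simp at h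
  have := leadingCoeff_ne_zero.2 h0
  rwa [leadingCoeff, natDegree_eq_of_degree_eq_some h] at this

lemma degree_eq_of_coeff_ne_zero {n : ℕ} (h : p.natDegree ≤ n) (hc : p.coeff n ≠ 0) :
    p.degree = n :=
  le_antisymm (natDegree_le_iff_degree_le.1 h) (le_degree_of_ne_zero hc)

lemma coeff_mul_eigen_ne_zero {n k : ℕ} (hp : p.degree = n) (hf : f.degree = k)
    (hl : hyper A B f = C l * f) (hne : l ≠ mu) :
    (p * (hyper A B f - C mu * f)).coeff (n + k) ≠ 0 := by
  rw [hl, ← sub_mul, ← C_sub, ← mul_assoc, mul_comm p, mul_assoc, coeff_C_mul,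
    coeff_mul_add_eq_of_natDegree_le (natDegree_eq_of_degree_eq_some hp).le
      (natDegree_eq_of_degree_eq_some hf).le]
  exact mul_ne_zero (sub_ne_zero.2 hne)
    (mul_ne_zero (coeff_natDegree_ne_zero hp) (coeff_natDegree_ne_zero hf))

/-- The product form serves twice: the right factor gives the degree of the transform, and the left
one, for `n = 0`, the injectivity of `lower J m`. -/
lemma raise_coeff_ne_zero {n k : ℕ} (h : Gauged A B K J E m) (hK : K.natDegree ≤ 1)
    (hE : E.natDegree ≤ 0) (hJ : J.natDegree ≤ 1)
    (hode : lower J m (E * p + K * derivative p) = C mu * p)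
    (hp : p.degree = n) (hf : f.degree = k) (hl : hyper A B f = C l * f) (hne : l ≠ mu) :
    (J.coeff 1 * ((n + k : ℕ) : ℂ) + m) * (raise K E p f).coeff (n + k) ≠ 0 := by
  have hd := natDegree_raise_le hK hE (natDegree_eq_of_degree_eq_some hp).le
    (natDegree_eq_of_degree_eq_some hf).le
  rw [← coeff_lower hJ (by omega), lower_raise h hode]
  exact coeff_mul_eigen_ne_zero hp hf hl hne

/-- Here `lower` is `c ∂`, so the transform has degree one more than `p (L - μ) f`. -/
lemma degree_raise_of_constant {n k : ℕ} (h : Gauged A B K (C c) E 0) (hK : K.natDegree ≤ 2)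
    (hE : E.natDegree ≤ 1)
    (hode : lower (C c) 0 (E * p + K * derivative p) = C mu * p)
    (hp : p.degree = n) (hf : f.degree = k) (hl : hyper A B f = C l * f) (hne : l ≠ mu) :
    (raise K E p f).degree = ((k + n + 1 : ℕ) : WithBot ℕ) := by
  refine degree_eq_of_coeff_ne_zero (natDegree_raise_le hK hE
    (natDegree_eq_of_degree_eq_some hp).le (natDegree_eq_of_degree_eq_some hf).le) ?_
  have := coeff_mul_eigen_ne_zero hp hf hl hne
  rw [← lower_raise h hode, lower_apply, map_zero, zero_mul, add_zero, coeff_C_mul,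
    coeff_derivative, add_comm n k] at this
  exact left_ne_zero_of_mul (right_ne_zero_of_mul this)

lemma natDegree_of_derivative {j : ℕ} (hI : derivative I = p) (hp : p.degree = j) :
    I.natDegree = j + 1 := by
  have h0 : I.natDegree ≠ 0 := by
    intro h
    rw [derivative_of_natDegree_zero h] at hI
    simp [← hI] at hp
  have := degree_derivative h0
  rw [hI, hp, Nat.cast_inj] at this
  omega

end Degree

/-! ### Multiplication by the antiderivative on the Darboux transforms. -/

section Recurrence

variable {A B K J E I q : ℂ[X]} {m mu c : ℂ} {P : ℕ → ℂ[X]} {lam : ℕ → ℂ} {j : ℕ}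

lemma intertwiner_mem_band (hA2 : A.natDegree ≤ 2) (hB1 : B.natDegree ≤ 1)
    (hP : ∀ n, hyper A B (P n) = C (lam n) * P n) (hX : ∀ n, X * P n ∈ band P 1 n)
    (hA : A = K * J) (hJE : (J * E).natDegree ≤ 1)
    (hI : derivative I = q) (hId : I.natDegree ≤ j + 1) (hq : q.natDegree ≤ j) (n : ℕ) :
    I * (hyper A B (P n) - C mu * P n) + J * raise K E q (P n) ∈ band P (j + 1) n := by
  have h : I * (hyper A B (P n) - C mu * P n) + J * raise K E q (P n) =
      (lam n - mu) • (I * P n) + A * q * derivative (P n)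
        - (A * derivative q + J * E * q) * P n := by
    rw [hP, raise_apply, smul_eq_C_mul, hA, C_sub]
    ring
  rw [h]
  refine Submodule.sub_mem _ (Submodule.add_mem _ ?_ ?_) ?_
  · exact Submodule.smul_mem _ _ (mul_mem_band hX hId n)
  · exact mul_derivative_mem_band hA2 hB1 hP hX hI hId hq n
  · refine mul_mem_band hX ((natDegree_add_le _ _).trans (max_le ?_ ?_)) n
    · exact (natDegree_mul_derivative_le (d := 1) hA2 hq).trans (by omega)
    · exact natDegree_mul_le.trans (by omega)

/-- Up to the kernel of `J ∂ + m`, the space of Darboux transforms is stable under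
multiplication by `I`. -/
lemma exists_lower_eq_zero (h : Gauged A B K J E m) (hA2 : A.natDegree ≤ 2) (hB1 : B.natDegree ≤ 1)
    (hP : ∀ n, hyper A B (P n) = C (lam n) * P n) (hX : ∀ n, X * P n ∈ band P 1 n)
    (hJE : (J * E).natDegree ≤ 1)
    (hI : derivative I = q) (hId : I.natDegree ≤ j + 1) (hq : q.natDegree ≤ j)
    (hode : lower J m (E * q + K * derivative q) = C mu * q) (hmu : ∀ n, lam n ≠ mu) (n : ℕ) :
    ∃ g ∈ band P (j + 1) n, lower J m (I * raise K E q (P n) - raise K E q g) = 0 := by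
  obtain ⟨g, hg, hgX⟩ := exists_hyper_sub_eq hP hmu
    (intertwiner_mem_band (mu := mu) hA2 hB1 hP hX h.mul_eq hJE hI hId hq n)
  refine ⟨g, hg, ?_⟩
  rw [map_sub, lower_mul_raise h hode hI, lower_raise h hode, hgX, sub_self]

lemma eq_zero_of_lower_eq_zero {y : ℂ[X]} (hJ : J.natDegree ≤ 1)
    (hne : ∀ k : ℕ, J.coeff 1 * k + m ≠ 0) (hy : lower J m y = 0) : y = 0 := by
  by_contra h0
  have := coeff_lower (m := m) hJ (le_refl y.natDegree)
  rw [hy, coeff_zero] at this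
  exact mul_ne_zero (hne _) (leadingCoeff_ne_zero.2 h0) this.symm

lemma exists_eq_C_of_lower_eq_zero {y : ℂ[X]} (hc : c ≠ 0) (hy : lower (C c) 0 y = 0) :
    ∃ a, y = C a := by
  rw [lower_apply, map_zero, zero_mul, add_zero, mul_eq_zero] at hy
  exact ⟨_, eq_C_of_derivative_eq_zero (hy.resolve_left (C_ne_zero.2 hc))⟩

lemma mul_raise_mem_map (h : Gauged A B K (C c) E 0) (hA2 : A.natDegree ≤ 2)
    (hB1 : B.natDegree ≤ 1)
    (hP : ∀ n, hyper A B (P n) = C (lam n) * P n) (hX : ∀ n, X * P n ∈ band P 1 n)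
    (hI : derivative I = q) (hId : I.natDegree ≤ j + 1) (hq : q.natDegree ≤ j)
    {n : ℕ} (hn : lam n ≠ 0) :
    I * raise K E q (P n) ∈ (band P (j + 1) n).map (raise K E q) := by
  refine ⟨_, ?_, (mul_raise_of_eigen h hI hn (hP n)).symm⟩
  have h2 := mul_derivative_mem_band hA2 hB1 hP hX hI hId hq n
  rw [← smul_eq_C_mul, ← mul_assoc, mul_comm q]
  exact Submodule.sub_mem _ (mul_mem_band hX hId n) (Submodule.smul_mem _ _ h2)

/-- By the factorization, `c (raise 1)' = -mu q`, so `raise 1` is itself a multiple of an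
antiderivative of `q`. -/
lemma antiderivative_eq (h : Gauged A B K (C c) E 0) (hc : c ≠ 0) (hI : derivative I = q)
    (hode : lower (C c) 0 (E * q + K * derivative q) = C mu * q) (hmu : mu ≠ 0) :
    ∃ a b : ℂ, I = C a * raise K E q 1 + C b := by
  have h1 : lower (C c) 0 (I - C (-(c * mu⁻¹)) * raise K E q 1) = 0 := by
    have := lower_raise h hode 1
    rw [← smul_eq_C_mul, map_sub, map_smul, this, lower_apply, hI, hyper_apply]
    have hm : C mu⁻¹ * C mu = (1 : ℂ[X]) := by rw [← C_mul, inv_mul_cancel₀ hmu, C_1]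
    simp only [derivative_one, smul_eq_C_mul, map_zero, C_neg, C_mul]
    linear_combination -C c * q * hm
  obtain ⟨b, hb⟩ := exists_eq_C_of_lower_eq_zero hc h1
  exact ⟨_, b, sub_eq_iff_eq_add'.1 hb⟩

end Recurrence

/-! ### Evaluation of `η` by residues. -/

section Residues

lemma loopIntegral_coe {f g : ℂ → ℂ} {a : ℂ} (hg : ∀ᶠ z in 𝓝 a, DifferentiableAt ℂ g z)
    (hf : ∀ᶠ z in 𝓝[≠] a, f z = (z - a)⁻¹ * g z) : loopIntegral f (a : OnePoint ℂ) = g a := by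
  obtain ⟨ε, hε, h⟩ := Metric.eventually_nhds_iff.1 (hg.and (eventually_nhdsWithin_iff.1 hf))
  refine Tendsto.limUnder_eq (tendsto_const_nhds.congr' ?_)
  filter_upwards [Ioo_mem_nhdsGT hε] with r hr
  have hsub : ∀ z ∈ Metric.closedBall a r, dist z a < ε := fun z hz =>
    (Metric.mem_closedBall.1 hz).trans_lt hr.2
  have h1 : (∮ z in C(a, r), f z) = ∮ z in C(a, r), (z - a)⁻¹ • g z := by
    refine circleIntegral.integral_congr hr.1.le fun z hz => ?_
    rw [smul_eq_mul]
    refine (h (hsub z (Metric.sphere_subset_closedBall hz))).2 ?_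
    exact Metric.ne_of_mem_sphere hz hr.1.ne'
  have h2 : DifferentiableOn ℂ g (Metric.closedBall a r) := fun z hz =>
    (h (hsub z hz)).1.differentiableWithinAt
  rw [h1, h2.circleIntegral_sub_inv_smul (Metric.mem_ball_self hr.1), smul_eq_mul,
    inv_mul_cancel_left₀ Complex.two_pi_I_ne_zero]

/-- On a large circle the two terms multiplied by `d` have cancelling residues. -/
lemma loopIntegral_infty {f : ℂ → ℂ} {a x c d : ℂ}
    (hf : ∀ z, z ≠ a → z ≠ x → f z = c * (z - x)⁻¹ + d * ((z - a)⁻¹ - (z - x)⁻¹)) :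
    loopIntegral f OnePoint.infty = -c := by
  refine Tendsto.limUnder_eq (tendsto_const_nhds.congr' ?_)
  filter_upwards [eventually_gt_atTop ‖a‖, eventually_gt_atTop ‖x‖] with r ha hx
  have hr : 0 < r := (norm_nonneg a).trans_lt ha
  have ha' : a ∈ Metric.ball (0 : ℂ) r := by simpa using ha
  have hx' : x ∈ Metric.ball (0 : ℂ) r := by simpa using hx
  have hne : ∀ {w : ℂ}, w ∈ Metric.ball (0 : ℂ) r → ∀ z ∈ Metric.sphere (0 : ℂ) r, z ≠ w := by
    rintro w hw z hz rfl
    exact (Metric.mem_ball.1 hw).ne (Metric.mem_sphere.1 hz)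
  have hint : ∀ {w : ℂ}, w ∈ Metric.ball (0 : ℂ) r →
      CircleIntegrable (fun z => (z - w)⁻¹) 0 r := fun hw =>
    ContinuousOn.circleIntegrable hr.le
      (ContinuousOn.inv₀ (by fun_prop) fun z hz => sub_ne_zero.2 (hne hw z hz))
  have h1 : (∮ z in C((0 : ℂ), r), f z) =
      ∮ z in C((0 : ℂ), r), (c • (z - x)⁻¹ + d • ((z - a)⁻¹ - (z - x)⁻¹)) :=
    circleIntegral.integral_congr hr.le fun z hz => hf z (hne ha' z hz) (hne hx' z hz)
  have hi1 : CircleIntegrable (fun z => c • (z - x)⁻¹) 0 r := (hint hx').const_smul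
  have hi2 : CircleIntegrable (fun z => (z - a)⁻¹ - (z - x)⁻¹) 0 r := (hint ha').sub (hint hx')
  have hi3 : CircleIntegrable (fun z => d • ((z - a)⁻¹ - (z - x)⁻¹)) 0 r := hi2.const_smul
  rw [h1, circleIntegral.integral_add hi1 hi3, circleIntegral.integral_smul,
    circleIntegral.integral_smul, circleIntegral.integral_sub (hint ha') (hint hx'),
    circleIntegral.integral_sub_inv_of_mem_ball ha',
    circleIntegral.integral_sub_inv_of_mem_ball hx', sub_self, smul_zero, add_zero, smul_eq_mul,
    mul_comm c, inv_mul_cancel_left₀ Complex.two_pi_I_ne_zero]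

variable {A B Q : ℂ[X]} {a x : ℂ}

lemma loopIntegral_integrand_self (hx : A.eval x ≠ 0) :
    loopIntegral (integrand A B x) (x : OnePoint ℂ) =
      (B.eval x - (derivative A).eval x) / A.eval x := by
  refine loopIntegral_coe (g := fun z => (B.eval z - (derivative A).eval z) / A.eval z) ?_ ?_
  · filter_upwards [A.continuous.continuousAt.eventually_ne hx] with z hz
    exact (B.differentiable.differentiableAt.sub
      (derivative A).differentiable.differentiableAt).div A.differentiable.differentiableAt hz
  · exact Eventually.of_forall fun z => by rw [integrand, one_div, mul_comm]

lemma loopIntegral_integrand_simple (hA : A = (X - C a) * Q) (hQ : Q.eval a ≠ 0) (hx : x ≠ a) :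
    loopIntegral (integrand A B x) (a : OnePoint ℂ) =
      (B.eval a - Q.eval a) / (Q.eval a * (a - x)) := by
  have hA' : (derivative A).eval a = Q.eval a := by rw [hA]; simp
  rw [← hA']
  nth_rw 2 [hA']
  have hne : ∀ᶠ z in 𝓝 a, Q.eval z * (z - x) ≠ 0 :=
    ContinuousAt.eventually_ne (by fun_prop) (mul_ne_zero hQ (sub_ne_zero.2 hx.symm))
  refine loopIntegral_coe
    (g := fun z => (B.eval z - (derivative A).eval z) / (Q.eval z * (z - x))) ?_ ?_
  · filter_upwards [hne] with z hz
    exact (B.differentiable.differentiableAt.sub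
      (derivative A).differentiable.differentiableAt).div
      (Q.differentiable.differentiableAt.mul (by fun_prop)) hz
  · filter_upwards [hne.filter_mono nhdsWithin_le_nhds, self_mem_nhdsWithin] with z hz hza
    have h1 : z - a ≠ 0 := sub_ne_zero.2 hza
    have h2 := left_ne_zero_of_mul hz
    have h3 := right_ne_zero_of_mul hz
    have h4 : A.eval z = (z - a) * Q.eval z := by rw [hA]; simp
    rw [integrand, h4]
    field_simp

lemma loopIntegral_integrand_infty {a₁ b₀ b₁ : ℂ} (ha₁ : a₁ ≠ 0) (hA : A = C a₁ * (X - C a))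
    (hB : B = C b₀ + C b₁ * X) (hx : x ≠ a) :
    loopIntegral (integrand A B x) OnePoint.infty = -(b₁ / a₁) := by
  -- Partial fractions: `d` is the residue of the integrand at `a`.
  refine loopIntegral_infty (a := a) (x := x)
    (d := (B.eval a - a₁) / (a₁ * (a - x))) fun z hza hzx => ?_
  have h1 : z - a ≠ 0 := sub_ne_zero.2 hza
  have h2 : z - x ≠ 0 := sub_ne_zero.2 hzx
  have h3 : a - x ≠ 0 := sub_ne_zero.2 hx.symm
  have h4 : (derivative A).eval z = a₁ := by rw [hA]; simp
  have h5 : A.eval z = a₁ * (z - a) := by rw [hA]; simp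
  rw [integrand, h4, h5, hB]
  simp only [eval_add, eval_mul, eval_C, eval_X]
  field_simp
  ring

end Residues

/-! ### What two distinct poles say about `A`. -/

section Poles

variable {A B : ℂ[X]} {a : ℂ} {ζ : OnePoint ℂ}

lemma degree_le_one_of_isPole_infty (hA2 : A.natDegree ≤ 2) (hB1 : B.natDegree ≤ 1)
    (h : IsPole A B OnePoint.infty) : A.degree ≤ 1 := by
  have h1 : (derivative A).natDegree ≤ 1 := (natDegree_derivative_le A).trans (by omega)
  exact h.2.trans (natDegree_le_iff_degree_le.1 ((natDegree_sub_le _ _).trans (max_le hB1 h1)))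

lemma eval_eq_zero_of_isPole (h : IsPole A B (a : OnePoint ℂ)) : A.eval a = 0 := by
  have h1 : 0 < A.rootMultiplicity a := (Nat.zero_le _).trans_lt h.2
  by_cases hA : A = 0
  · simp [hA]
  · exact (rootMultiplicity_pos hA).1 h1

/-- A double root at `a` would exhaust the degree of `A`: no other finite root remains, and a pole
at infinity needs `deg A ≤ 1`. -/
lemma exists_simple_root (hA : A ≠ 0) (hA2 : A.natDegree ≤ 2) (hB1 : B.natDegree ≤ 1)
    (ha : IsPole A B (a : OnePoint ℂ)) (hζ : IsPole A B ζ) (hne : ζ ≠ a) :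
    ∃ Q : ℂ[X], A = (X - C a) * Q ∧ Q.eval a ≠ 0 ∧ Q.natDegree ≤ 1 := by
  obtain ⟨Q, rfl⟩ := dvd_iff_isRoot.2 (eval_eq_zero_of_isPole ha)
  have hQ0 : Q ≠ 0 := right_ne_zero_of_mul hA
  rw [natDegree_mul (X_sub_C_ne_zero a) hQ0, natDegree_X_sub_C] at hA2
  refine ⟨Q, rfl, fun hQ => ?_, by omega⟩
  obtain ⟨R, rfl⟩ := dvd_iff_isRoot.2 hQ
  have hR0 : R ≠ 0 := right_ne_zero_of_mul hQ0
  rw [natDegree_mul (X_sub_C_ne_zero a) hR0, natDegree_X_sub_C] at hA2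
  obtain ⟨r, rfl⟩ : ∃ r, R = C r := ⟨_, eq_C_of_natDegree_eq_zero (by omega)⟩
  induction ζ using OnePoint.rec with
  | infty =>
    have := degree_le_one_of_isPole_infty (by
      rw [natDegree_mul (X_sub_C_ne_zero a) hQ0, natDegree_mul (X_sub_C_ne_zero a) hR0]
      simp) hB1 hζ
    rw [degree_mul, degree_mul, degree_X_sub_C, degree_C (C_ne_zero.1 hR0)] at this
    exact absurd this (by decide)
  | coe b =>
    have := eval_eq_zero_of_isPole hζ
    have hr : r ≠ 0 := C_ne_zero.1 hR0
    simp only [eval_mul, eval_sub, eval_X, eval_C, mul_eq_zero, hr, or_false, or_self,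
      sub_eq_zero] at this
    exact hne (by rw [this])

lemma exists_linear (hA : A ≠ 0) (hA2 : A.natDegree ≤ 2) (hB1 : B.natDegree ≤ 1)
    (ha : IsPole A B (a : OnePoint ℂ)) (h : IsPole A B OnePoint.infty) :
    ∃ a₁ : ℂ, a₁ ≠ 0 ∧ A = C a₁ * (X - C a) := by
  have h1 := degree_le_one_of_isPole_infty hA2 hB1 h
  obtain ⟨Q, rfl⟩ := dvd_iff_isRoot.2 (eval_eq_zero_of_isPole ha)
  have hQ0 : Q ≠ 0 := right_ne_zero_of_mul hA
  have h2 : ((X - C a) * Q).natDegree ≤ 1 := natDegree_le_iff_degree_le.2 h1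
  rw [natDegree_mul (X_sub_C_ne_zero a) hQ0, natDegree_X_sub_C] at h2
  obtain ⟨r, rfl⟩ : ∃ r, Q = C r := ⟨_, eq_C_of_natDegree_eq_zero (by omega)⟩
  exact ⟨r, C_ne_zero.1 hQ0, mul_comm _ _⟩

end Poles

/-! ### From the gauge factor to polynomial data. -/

section Gauge

variable {A B K J E G f : ℂ[X]} {m c a : ℂ}

lemma Gauged.smul (h : Gauged A B K J E m) (hc : c ≠ 0) :
    Gauged A B (C c * K) (C c⁻¹ * J) (C c * E) (c⁻¹ * m) := by
  obtain ⟨rfl, h2⟩ := h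
  have hcc : (C c * C c⁻¹ : ℂ[X]) = 1 := by rw [← C_mul, mul_inv_cancel₀ hc, C_1]
  constructor
  · linear_combination (-K * J) * hcc
  · rw [derivative_C_mul, C_mul]
    linear_combination h2 + (J * E - J * derivative K - C m * K) * hcc

lemma infinite_eval_ne_zero (hA : A ≠ 0) : {x | A.eval x ≠ 0}.Infinite := by
  have : {x | A.IsRoot x}.Finite := by
    by_contra h
    exact hA (eq_zero_of_infinite_isRoot A h)
  exact this.infinite_compl

/-- Top coefficients show that every nonzero solution has the degree of `K`. Subtracting the
multiple of `K` with the same leading coefficient leaves a solution of smaller degree, hence zero.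
-/
lemma eq_C_mul_of_derivative_mul_eq (hK : K ≠ 0) (hG : G ≠ 0)
    (h : derivative G * K = derivative K * G) : ∃ c : ℂ, c ≠ 0 ∧ G = C c * K := by
  have key : ∀ H : ℂ[X], H ≠ 0 → derivative H * K = derivative K * H →
      H.natDegree = K.natDegree := by
    intro H hH hHK
    have h1 := congrArg (fun q => coeff q (H.natDegree + K.natDegree - 1)) hHK
    by_cases h0 : H.natDegree + K.natDegree = 0
    · omega
    have e : ∀ U V : ℂ[X], U.natDegree + V.natDegree ≠ 0 →
        (derivative U * V).coeff (U.natDegree + V.natDegree - 1) =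
          U.natDegree * (U.leadingCoeff * V.leadingCoeff) := by
      intro U V hUV
      by_cases hU : U.natDegree = 0
      · rw [derivative_of_natDegree_zero hU, hU]; simp
      obtain ⟨k, hk⟩ := Nat.exists_eq_succ_of_ne_zero hU
      have h3 : (derivative U).natDegree ≤ k := (natDegree_derivative_le U).trans (by omega)
      have h4 : U.natDegree + V.natDegree - 1 = k + V.natDegree := by omega
      rw [h4, coeff_mul_add_eq_of_natDegree_le h3 le_rfl, coeff_derivative, leadingCoeff,
        leadingCoeff, hk]
      push_cast
      ring
    simp only [e H K h0] at h1
    rw [add_comm, e K H (by omega), mul_comm K.leadingCoeff] at h1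
    exact_mod_cast mul_right_cancel₀
      (mul_ne_zero (leadingCoeff_ne_zero.2 hH) (leadingCoeff_ne_zero.2 hK)) h1
  have hc : G.leadingCoeff / K.leadingCoeff ≠ 0 :=
    div_ne_zero (leadingCoeff_ne_zero.2 hG) (leadingCoeff_ne_zero.2 hK)
  refine ⟨_, hc, ?_⟩
  by_contra hne
  have hdeg : G.degree = (C (G.leadingCoeff / K.leadingCoeff) * K).degree := by
    rw [degree_C_mul hc, degree_eq_natDegree hG, degree_eq_natDegree hK, key G hG h]
  have hlt := degree_sub_lt_left hdeg hG (by
    rw [leadingCoeff_mul, leadingCoeff_C, div_mul_cancel₀ _ (leadingCoeff_ne_zero.2 hK)])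
  have hd := key _ (sub_ne_zero.2 hne) (by
    rw [derivative_sub, derivative_C_mul]
    linear_combination h)
  rw [degree_eq_natDegree (sub_ne_zero.2 hne), hd, degree_eq_natDegree hG, key G hG h] at hlt
  exact lt_irrefl _ hlt

lemma IsGaugePart.eq_C_mul {γ : Curve} (hA : A ≠ 0) (hK : K ≠ 0) (hG : IsGaugePart A γ G)
    (h : ∀ x, A.eval x ≠ 0 → eta A 0 γ x * K.eval x = (derivative K).eval x) :
    ∃ c : ℂ, c ≠ 0 ∧ G = C c * K := by
  refine eq_C_mul_of_derivative_mul_eq hK hG.1 (eq_of_infinite_eval_eq _ _ ?_)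
  refine (infinite_eval_ne_zero hA).mono fun x hx => ?_
  rw [Set.mem_ofPred_eq, eval_mul, eval_mul, hG.2 x hx, ← h x hx]
  ring

/-- The polynomial data attached to a gauge factor: `A = G J` and `η = E / G`. -/
lemma exists_gauged_of_eta {γ : Curve} (hA : A ≠ 0) (hK : K ≠ 0) (hG : IsGaugePart A γ G)
    (hKJ : Gauged A B K J E m)
    (hη₀ : ∀ x, A.eval x ≠ 0 → eta A 0 γ x * K.eval x = (derivative K).eval x)
    (hη : ∀ x, A.eval x ≠ 0 → eta A B γ x * K.eval x = E.eval x) :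
    ∃ c : ℂ, c ≠ 0 ∧ G.natDegree ≤ K.natDegree ∧ Gauged A B G (C c⁻¹ * J) (C c * E) (c⁻¹ * m) ∧
      ∀ x, A.eval x ≠ 0 → eta A B γ x * G.eval x = (C c * E).eval x := by
  obtain ⟨c, hc, rfl⟩ := hG.eq_C_mul hA hK hη₀
  refine ⟨c, hc, natDegree_C_mul_le _ _, hKJ.smul hc, fun x hx => ?_⟩
  rw [eval_C_mul, eval_C_mul, ← hη x hx]
  ring

/-- The value of `E` is the one for which `E Q + B - Q` vanishes at `a`; the quotient by `X - C a`
is constant for degree reasons. -/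
lemma gauged_simple {Q : ℂ[X]} (hA : A = (X - C a) * Q) (hQ : Q.eval a ≠ 0)
    (hQ1 : Q.natDegree ≤ 1) (hB1 : B.natDegree ≤ 1) :
    ∃ m, Gauged A B (X - C a) Q (C (-((B.eval a - Q.eval a) / Q.eval a))) m := by
  set s := -((B.eval a - Q.eval a) / Q.eval a) with hs
  obtain ⟨R, hR⟩ : X - C a ∣ C s * Q + B - Q := by
    refine dvd_iff_isRoot.2 ?_
    simp only [IsRoot.def, eval_sub, eval_add, eval_mul, eval_C, hs]
    field_simp
    ring
  have hR0 : R.natDegree = 0 := by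
    by_cases h0 : R = 0
    · simp [h0]
    have h1 : (C s * Q + B - Q).natDegree ≤ 1 :=
      (natDegree_sub_le _ _).trans (max_le ((natDegree_add_le _ _).trans
        (max_le ((natDegree_C_mul_le _ _).trans hQ1) hB1)) hQ1)
    rw [hR, natDegree_mul (X_sub_C_ne_zero a) h0, natDegree_X_sub_C] at h1
    omega
  refine ⟨R.coeff 0, hA, ?_⟩
  rw [← eq_C_of_natDegree_eq_zero hR0, derivative_X_sub_C]
  linear_combination hR

end Gauge

/-! ### The gauge data of each type. -/

section Types

variable {A B G : ℂ[X]}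

lemma exists_gauged_III (hA : A ≠ 0) (hA2 : A.natDegree ≤ 2) (hB1 : B.natDegree ≤ 1)
    (hG : IsGaugePart A .III G) :
    ∃ (E : ℂ[X]) (c : ℂ), c ≠ 0 ∧ G.natDegree ≤ 2 ∧ E.natDegree ≤ 1 ∧ Gauged A B G (C c) E 0 ∧
      ∀ x, A.eval x ≠ 0 → eta A B .III x * G.eval x = E.eval x := by
  have hη : ∀ B : ℂ[X], ∀ x, A.eval x ≠ 0 →
      eta A B .III x * A.eval x = (derivative A - B).eval x := by
    intro B x hx
    rw [eta, loopIntegral_integrand_self hx, eval_sub]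
    field_simp
    ring
  have h0 : Gauged A B A 1 (derivative A - B) 0 := ⟨by ring, by rw [map_zero]; ring⟩
  obtain ⟨c, hc, h1, h2, h3⟩ := exists_gauged_of_eta hA hA hG h0
    (fun x hx => by rw [hη 0 x hx, sub_zero]) (hη B)
  rw [mul_one, mul_zero] at h2
  have hd := natDegree_derivative_le A
  exact ⟨_, c⁻¹, inv_ne_zero hc, h1.trans hA2, (natDegree_C_mul_le _ _).trans
    ((natDegree_sub_le _ _).trans (max_le (by omega) hB1)), h2, h3⟩

lemma exists_gauged_of_simple_root {γ : Curve} {Q : ℂ[X]} {a : ℂ} (hA0 : A ≠ 0)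
    (hA : A = (X - C a) * Q) (hQ : Q.eval a ≠ 0) (hQ1 : Q.natDegree ≤ 1) (hB1 : B.natDegree ≤ 1)
    (hγ : ∀ B x, eta A B γ x = loopIntegral (integrand A B x) (a : OnePoint ℂ))
    (hG : IsGaugePart A γ G) :
    ∃ (J E : ℂ[X]) (m : ℂ), G.natDegree ≤ 1 ∧ E.natDegree ≤ 0 ∧ J.natDegree ≤ 1 ∧
      Gauged A B G J E m ∧ ∀ x, A.eval x ≠ 0 → eta A B γ x * G.eval x = E.eval x := by
  have hη : ∀ B : ℂ[X], ∀ x, A.eval x ≠ 0 →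
      eta A B γ x * (X - C a).eval x = -((B.eval a - Q.eval a) / Q.eval a) := by
    intro B x hx
    have hxa : x ≠ a := by rintro rfl; simp [hA] at hx
    have h1 : a - x ≠ 0 := sub_ne_zero.2 hxa.symm
    rw [hγ, loopIntegral_integrand_simple hA hQ hxa, eval_sub, eval_X, eval_C]
    field_simp
    ring
  obtain ⟨m, hm⟩ := gauged_simple hA hQ hQ1 hB1
  obtain ⟨c, hc, h1, h2, h3⟩ := exists_gauged_of_eta hA0 (X_sub_C_ne_zero a) hG hm
    (fun x hx => by rw [hη 0 x hx, eval_zero, derivative_X_sub_C, eval_one]; field_simp; ring)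
    (fun x hx => by rw [hη B x hx, eval_C])
  refine ⟨_, _, _, h1.trans (natDegree_X_sub_C a).le, ?_, ?_, h2, h3⟩
  · rw [← C_mul, natDegree_C]
  · exact (natDegree_C_mul_le _ _).trans hQ1

/-- Here `η = -b₁ / a₁` is constant, so `ξ` is an exponential and, up to constants, `K = 1` and `J =
A`. -/
lemma exists_gauged_of_infty {γ : Curve} {a a₁ : ℂ} (ha₁ : a₁ ≠ 0)
    (hA : A = C a₁ * (X - C a)) (hB1 : B.natDegree ≤ 1)
    (hγ : ∀ B x, eta A B γ x = loopIntegral (integrand A B x) OnePoint.infty)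
    (hG : IsGaugePart A γ G) :
    ∃ (J E : ℂ[X]) (m : ℂ), G.natDegree ≤ 1 ∧ E.natDegree ≤ 0 ∧ J.natDegree ≤ 1 ∧
      Gauged A B G J E m ∧ ∀ x, A.eval x ≠ 0 → eta A B γ x * G.eval x = E.eval x := by
  obtain ⟨b₀, b₁, hB⟩ : ∃ b₀ b₁, B = C b₀ + C b₁ * X := by
    refine ⟨B.coeff 0, B.coeff 1, ?_⟩
    conv_lhs => rw [B.as_sum_range_C_mul_X_pow' (n := 2) (by omega)]
    simp [Finset.sum_range_succ]
  have hA0 : A ≠ 0 := by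
    rw [hA]; exact mul_ne_zero (C_ne_zero.2 ha₁) (X_sub_C_ne_zero a)
  have hxa : ∀ x, A.eval x ≠ 0 → x ≠ a := by
    rintro x hx rfl; simp [hA] at hx
  have hm : Gauged A B 1 A (C (-(b₁ / a₁))) (b₀ + b₁ * a) := by
    refine ⟨by ring, ?_⟩
    have : (C a₁ * C (-(b₁ / a₁)) : ℂ[X]) = -C b₁ := by
      rw [← C_mul, ← C_neg]; congr 1; field_simp
    rw [derivative_one, hA, hB, C_add, C_mul]
    linear_combination (X - C a) * this
  obtain ⟨c, hc, h1, h2, h3⟩ := exists_gauged_of_eta hA0 one_ne_zero hG hm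
    (fun x hx => by
      rw [hγ, loopIntegral_integrand_infty (b₀ := 0) (b₁ := 0) ha₁ hA (by simp) (hxa x hx)]
      simp)
    (fun x hx => by
      rw [hγ, loopIntegral_integrand_infty ha₁ hA hB (hxa x hx)]
      simp)
  refine ⟨_, _, _, h1.trans (by simp), ?_, ?_, h2, h3⟩
  · rw [← C_mul, natDegree_C]
  · refine (natDegree_C_mul_le _ _).trans ?_
    rw [hA]
    exact (natDegree_C_mul_le _ _).trans (natDegree_X_sub_C a).le

lemma exists_gauged_I_II (hA : A ≠ 0) (hA2 : A.natDegree ≤ 2) (hB1 : B.natDegree ≤ 1)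
    {ρ : Curve} (hρ : ρ.Exists A B) (hIII : ρ ≠ .III) (hG : IsGaugePart A ρ G) :
    ∃ (J E : ℂ[X]) (m : ℂ), G.natDegree ≤ 1 ∧ E.natDegree ≤ 0 ∧ J.natDegree ≤ 1 ∧
      Gauged A B G J E m ∧ ∀ x, A.eval x ≠ 0 → eta A B ρ x * G.eval x = E.eval x := by
  cases ρ with
  | I a₁ a₂ =>
    obtain ⟨h1, h2, h3⟩ := hρ
    have hp₁ : IsPole A B a₁ := by have : a₁ ∈ {ζ | IsPole A B ζ} := by simp [h3]
                                   exact this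
    have hp₂ : IsPole A B a₂ := by have : a₂ ∈ {ζ | IsPole A B ζ} := by simp [h3]
                                   exact this
    obtain ⟨a, rfl⟩ := OnePoint.ne_infty_iff_exists.1 h1
    obtain ⟨Q, hQA, hQ, hQ1⟩ := exists_simple_root hA hA2 hB1 hp₁ hp₂ h2.symm
    exact exists_gauged_of_simple_root hA hQA hQ hQ1 hB1 (fun _ _ => rfl) hG
  | II a₁ a₂ =>
    obtain ⟨h1, h2, h3⟩ := hρ
    have hp₁ : IsPole A B a₁ := by have : a₁ ∈ {ζ | IsPole A B ζ} := by simp [h3]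
                                   exact this
    have hp₂ : IsPole A B a₂ := by have : a₂ ∈ {ζ | IsPole A B ζ} := by simp [h3]
                                   exact this
    obtain ⟨a, rfl⟩ := OnePoint.ne_infty_iff_exists.1 h1
    induction a₂ using OnePoint.rec with
    | infty =>
      obtain ⟨k, hk, hAk⟩ := exists_linear hA hA2 hB1 hp₁ hp₂
      exact exists_gauged_of_infty hk hAk hB1 (fun _ _ => rfl) hG
    | coe b =>
      obtain ⟨Q, hQA, hQ, hQ1⟩ := exists_simple_root hA hA2 hB1 hp₂ hp₁ h2
      exact exists_gauged_of_simple_root hA hQA hQ hQ1 hB1 (fun _ _ => rfl) hG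
  | III => exact absurd rfl hIII

end Types

/-! ### Passage from functions on `Ω` to polynomials. -/

section Seed

variable {A B G J E p : ℂ[X]} {m mu : ℂ} {Ω : Set ℂ} {ξ η : ℂ → ℂ}

lemma hasDerivAt_quasi {x : ℂ} (hG : G.eval x ≠ 0) (hη : η x * G.eval x = E.eval x)
    (hξ : HasDerivAt ξ (η x * ξ x) x) :
    HasDerivAt (quasi ξ p) (ξ x / G.eval x * (E * p + G * derivative p).eval x) x := by
  have h := hξ.mul (p.hasDerivAt x)
  refine h.congr_deriv ?_
  rw [eval_add, eval_mul, eval_mul, ← hη]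
  field_simp

/-- With `q = E p + G p'` one has `φ' = (ξ / G) q`, and the gauge equation gives `L φ = ξ (J q' + m
q)`. Dividing by `ξ` leaves a polynomial identity on an infinite set. -/
lemma lower_seed (hG : Gauged A B G J E m) (hΩ : IsOpen Ω) (hΩne : Ω.Nonempty)
    (hAΩ : ∀ x ∈ Ω, A.eval x ≠ 0) (hη : ∀ x ∈ Ω, η x * G.eval x = E.eval x)
    (hξ : ∀ x ∈ Ω, ξ x ≠ 0 ∧ HasDerivAt ξ (η x * ξ x) x)
    (hp : ∀ x ∈ Ω, opL A B (quasi ξ p) x = mu * quasi ξ p x) :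
    lower J m (E * p + G * derivative p) = C mu * p := by
  have hinf : Ω.Infinite := infinite_of_mem_nhds hΩne.some (hΩ.mem_nhds hΩne.some_mem)
  have hGΩ : ∀ x ∈ Ω, G.eval x ≠ 0 := fun x hx h0 => hAΩ x hx (by simp [hG.mul_eq, h0])
  refine eq_of_infinite_eval_eq _ _ (hinf.mono fun x hx => ?_)
  set q := E * p + G * derivative p with hq
  have h1 : ∀ y ∈ Ω, deriv (quasi ξ p) y = ξ y / G.eval y * q.eval y := fun y hy =>
    (hasDerivAt_quasi (hGΩ y hy) (hη y hy) (hξ y hy).2).deriv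
  have h2 : deriv (quasi ξ p) =ᶠ[𝓝 x] fun y => ξ y / G.eval y * q.eval y := by
    filter_upwards [hΩ.mem_nhds hx] with y hy using h1 y hy
  have h3 := (((hξ x hx).2.div (G.hasDerivAt x) (hGΩ x hx)).mul (q.hasDerivAt x)).deriv
  have h4 := hp x hx
  have hx0 := (hξ x hx).1
  have hg := hGΩ x hx
  have hB := congrArg (eval x) hG.gauge_eq
  have hη' := hη x hx
  rw [opL, h2.deriv_eq, h1 x hx, quasi] at h4
  rw [show (fun y => ξ y / G.eval y * q.eval y) = (ξ / fun y => G.eval y) * fun y => q.eval y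
    from rfl, h3, hG.mul_eq] at h4
  simp only [Pi.div_apply] at h4
  simp only [eval_add, eval_sub, eval_mul, eval_C] at hB h4
  rw [Set.mem_ofPred_eq, lower_apply, eval_add, eval_mul, eval_mul, eval_mul, eval_C, eval_C]
  field_simp at h4
  apply mul_left_cancel₀ hg
  linear_combination h4 - q.eval x * hB - J.eval x * q.eval x * hη'

lemma darboux_eq_raise {x : ℂ} (hG : G.eval x ≠ 0) (hη : η x * G.eval x = E.eval x)
    (hξ0 : ξ x ≠ 0) (hξ : HasDerivAt ξ (η x * ξ x) x) (f : ℂ[X]) :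
    darboux G ξ (quasi ξ p) (fun y => f.eval y) x = (raise G E p f).eval x := by
  rw [darboux, (hasDerivAt_quasi hG hη hξ).deriv, Polynomial.deriv, quasi, raise_apply]
  simp only [eval_add, eval_sub, eval_mul]
  field_simp
  ring

end Seed

/-! ### Index windows of the recurrence. -/

section Window

variable {P : ℕ → ℂ[X]} {Q : ℤ → ℂ[X]} {j n : ℕ} {N : ℤ}

/-- The span of the `Q (N + l)` with `|l| ≤ j + 1`. -/
def window (Q : ℤ → ℂ[X]) (j : ℕ) (N : ℤ) : Submodule ℂ ℂ[X] :=
  Submodule.span ℂ ((fun l => Q (N + l)) '' (Finset.Icc (-(j : ℤ) - 1) ((j : ℤ) + 1) : Set ℤ))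

lemma mem_window {i : ℤ} (h₁ : N - j - 1 ≤ i) (h₂ : i ≤ N + j + 1) : Q i ∈ window Q j N :=
  Submodule.subset_span
    ⟨i - N, Finset.mem_coe.2 (Finset.mem_Icc.2 ⟨by omega, by omega⟩), by simp⟩

lemma exists_sum_of_mem_window {f : ℂ[X]} (hf : f ∈ window Q j N) :
    ∃ β : ℤ → ℂ, f = ∑ l ∈ Finset.Icc (-(j : ℤ) - 1) ((j : ℤ) + 1), C (β l) * Q (N + l) := by
  obtain ⟨c, rfl⟩ := (Submodule.mem_span_image_finset_iff_exists_fun ℂ).1 hf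
  refine ⟨fun l => if h : l ∈ Finset.Icc (-(j : ℤ) - 1) ((j : ℤ) + 1) then c ⟨l, h⟩ else 0, ?_⟩
  rw [← Finset.sum_coe_sort (Finset.Icc (-(j : ℤ) - 1) ((j : ℤ) + 1))]
  refine Finset.sum_congr rfl fun l _ => ?_
  simp only [dif_pos l.2, smul_eq_C_mul]

lemma map_band_le_window {T : ℂ[X] →ₗ[ℂ] ℂ[X]} {s : ℤ} (hT : ∀ k : ℕ, T (P k) = Q (k + s)) :
    (band P (j + 1) n).map T ≤ window Q j (n + s) := by
  rw [band, Submodule.map_span_le]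
  rintro _ ⟨k, hk, rfl⟩
  rw [Set.mem_ofPred_eq] at hk
  rw [hT]
  exact mem_window (by omega) (by omega)

end Window

end XOP

end

/-! ### Assembly: type III, then types I and II. -/

theorem theorem1
    -- the operator `A ∂² + B ∂`
    (A B : ℂ[X]) (hA : A ≠ 0) (hA2 : A.natDegree ≤ 2) (hB : B.natDegree = 1)
    -- the classical polynomials `P n` and their eigenvalues `lam n`
    (P : ℕ → ℂ[X]) (lam : ℕ → ℂ) (hPdeg : ∀ n, (P n).degree = (n : ℕ))
    (hP : ∀ n, A * derivative (derivative (P n)) + B * derivative (P n) = C (lam n) * P n)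
    -- the type, the gauge factor `ξ` on `Ω`, and the polynomial `G = A_ρ`
    (ρ : XOP.Curve) (hρ : ρ.Exists A B)
    (Ω : Set ℂ) (hΩ : IsOpen Ω) (hΩne : Ω.Nonempty) (hAΩ : ∀ x ∈ Ω, A.eval x ≠ 0)
    (ξ : ℂ → ℂ) (hξ : XOP.IsGauge A B ρ Ω ξ)
    (G : ℂ[X]) (hG : XOP.IsGaugePart A ρ G)
    -- the quasi-polynomial eigenfunctions `ξ p n` and their eigenvalues `mu n`
    (p : ℕ → ℂ[X]) (mu : ℕ → ℂ) (hpdeg : ∀ n, (p n).degree = (n : ℕ))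
    (hp : ∀ n, ∀ x ∈ Ω, XOP.opL A B (XOP.quasi ξ (p n)) x = mu n * XOP.quasi ξ (p n) x)
    -- the spectral parameters are mutually distinct
    (hlam : Function.Injective lam) (hmu : Function.Injective mu)
    (hlm : ∀ m n, lam m ≠ mu n)
    -- the degree of the seed, and an antiderivative of its polynomial part
    (j : ℕ) (Ij : ℂ[X]) (hIj : derivative Ij = p j) :
    Ij.natDegree = j + 1 ∧
    ∃ Phat : ℤ → ℂ[X],
      (∀ n : ℤ, ∀ x ∈ Ω, (Phat n).eval x =
        XOP.xop ρ j
          (fun m => XOP.darboux G ξ (XOP.quasi ξ (p j)) (fun y => (P m).eval y)) n x) ∧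
      XOP.HasXOPDegrees ρ j Phat ∧
      ∃ β : ℤ → ℤ → ℂ, ∀ n : ℤ, Phat n ≠ 0 →
        Ij * Phat n =
          ∑ l ∈ Finset.Icc (-(j : ℤ) - 1) ((j : ℤ) + 1), C (β n l) * Phat (n + l) := by
  have hP' : ∀ n, XOP.hyper A B (P n) = C (lam n) * P n := hP
  have hId := XOP.natDegree_of_derivative hIj (hpdeg j)
  have hpj : (p j).natDegree ≤ j := (natDegree_eq_of_degree_eq_some (hpdeg j)).le
  have hX := XOP.X_mul_mem_band_one hA2 hB.le hPdeg hP' hlam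
  refine ⟨hId, ?_⟩
  suffices h : ∃ Phat : ℤ → ℂ[X],
      (∀ n : ℤ, ∀ x ∈ Ω, (Phat n).eval x =
        XOP.xop ρ j
          (fun m => XOP.darboux G ξ (XOP.quasi ξ (p j)) (fun y => (P m).eval y)) n x) ∧
      XOP.HasXOPDegrees ρ j Phat ∧
      ∀ n : ℤ, Phat n ≠ 0 → Ij * Phat n ∈ XOP.window Phat j n by
    obtain ⟨Phat, h1, h2, h3⟩ := h
    have h4 : ∀ n : ℤ, ∃ β : ℤ → ℂ, Phat n ≠ 0 → Ij * Phat n =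
        ∑ l ∈ Finset.Icc (-(j : ℤ) - 1) ((j : ℤ) + 1), C (β l) * Phat (n + l) := by
      intro n
      by_cases hn : Phat n = 0
      · exact ⟨0, fun h => absurd hn h⟩
      · obtain ⟨β, hβ⟩ := XOP.exists_sum_of_mem_window (h3 n hn)
        exact ⟨β, fun _ => hβ⟩
    choose β hβ using h4
    exact ⟨Phat, h1, h2, β, hβ⟩
  by_cases hIII : ρ = .III
  · subst hIII
    obtain ⟨E, c, hc, hG2, hE1, hGa, hη⟩ := XOP.exists_gauged_III hA hA2 hB.le hG
    have hode := XOP.lower_seed hGa hΩ hΩne hAΩ (fun x hx => hη x (hAΩ x hx)) hξ (hp j)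
    have hGx : ∀ x ∈ Ω, G.eval x ≠ 0 := fun x hx h0 => hAΩ x hx (by simp [hGa.mul_eq, h0])
    have hdarb : ∀ (f : ℂ[X]), ∀ x ∈ Ω,
        XOP.darboux G ξ (XOP.quasi ξ (p j)) (fun y => f.eval y) x
          = (XOP.raise G E (p j) f).eval x := fun f x hx =>
      XOP.darboux_eq_raise (hGx x hx) (hη x (hAΩ x hx)) (hξ x hx).1 (hξ x hx).2 f
    set T := XOP.raise G E (p j)
    let Phat : ℤ → ℂ[X] := fun n =>
      if n = 0 then 1 else if (j : ℤ) + 1 ≤ n then T (P (n - j - 1).toNat) else 0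
    have hPhat0 : Phat 0 = 1 := if_pos rfl
    have hC : ∀ b : ℂ, C b = b • Phat 0 := fun b => by rw [hPhat0, smul_eq_C_mul, mul_one]
    have hPhatT : ∀ k : ℕ, T (P k) = Phat (k + (j + 1)) := by
      intro k
      have h1 : ((k : ℤ) + (j + 1)) ≠ 0 := by omega
      have h2 : (j : ℤ) + 1 ≤ k + (j + 1) := by omega
      have h3 : ((k : ℤ) + (j + 1) - j - 1).toNat = k := by omega
      simp only [Phat, if_neg h1, if_pos h2, h3]
    have hlam0 : lam 0 = 0 := by
      have h1 := hP 0
      have h2 : (P 0).natDegree = 0 := natDegree_eq_of_degree_eq_some (hPdeg 0)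
      rw [derivative_of_natDegree_zero h2, derivative_zero, mul_zero, mul_zero, add_zero,
        eq_comm, mul_eq_zero, C_eq_zero] at h1
      refine h1.resolve_right ?_
      intro h0
      have := hPdeg 0
      simp [h0] at this
    obtain ⟨u, hu⟩ : ∃ u, P 0 = C u :=
      ⟨_, eq_C_of_natDegree_eq_zero (natDegree_eq_of_degree_eq_some (hPdeg 0))⟩
    have hu0 : u ≠ 0 := by
      rintro rfl
      have := hPdeg 0
      simp [hu] at this
    refine ⟨Phat, fun n x hx => ?_, ?_, fun n hn => ?_⟩
    · simp only [XOP.xop, Phat]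
      split_ifs with h0 h1
      · rw [eval_one]
      · exact (hdarb _ x hx).symm
      · rw [eval_zero]
    · rintro n (rfl | hn)
      · rw [Nat.cast_zero, hPhat0]
        exact degree_one
      · obtain ⟨k, rfl⟩ := Nat.exists_eq_add_of_le' hn
        have := hPhatT k
        rw [Nat.cast_add, Nat.cast_add, Nat.cast_one, ← this,
          XOP.degree_raise_of_constant hGa hG2 hE1 hode (hpdeg j) (hPdeg k) (hP' k) (hlm k j)]
        rfl
    · by_cases h0 : n = 0
      · subst h0
        -- At index `0` only the indices `j + 1` (through `T 1`) and `0` occur.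
        obtain ⟨a, b, hab⟩ := XOP.antiderivative_eq hGa hc hIj hode (hlam0 ▸ (hlm 0 j).symm)
        have h1 : T 1 = u⁻¹ • Phat (j + 1) := by
          have := hPhatT 0
          rw [Nat.cast_zero, zero_add] at this
          rw [← this, ← map_smul, hu, smul_eq_C_mul, ← C_mul, inv_mul_cancel₀ hu0, C_1]
        rw [hPhat0, mul_one, hab, h1, ← smul_eq_C_mul, hC]
        exact Submodule.add_mem _
          (Submodule.smul_mem _ _ (Submodule.smul_mem _ _ (XOP.mem_window (by omega) (by omega))))
          (Submodule.smul_mem _ _ (XOP.mem_window (by omega) (by omega)))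
      · have h1 : (j : ℤ) + 1 ≤ n := by
          by_contra h1
          exact hn (by simp only [Phat, if_neg h0, if_neg h1])
        obtain ⟨k, rfl⟩ : ∃ k : ℕ, n = k + (j + 1) := ⟨(n - j - 1).toNat, by omega⟩
        rw [← hPhatT]
        by_cases hk : k = 0
        · subst hk
          -- As `lam 0 = 0`, the explicit preimage is not available; the constant left over is
          -- harmless, since the window of `j + 1` just reaches index `0`.
          obtain ⟨g, hg, hlow⟩ := XOP.exists_lower_eq_zero hGa hA2 hB.le hP' hX
            ((natDegree_C_mul_le _ _).trans hE1) hIj hId.le hpj hode (fun n => hlm n j) 0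
          obtain ⟨a, ha⟩ := XOP.exists_eq_C_of_lower_eq_zero hc hlow
          rw [sub_eq_iff_eq_add.1 ha, hC]
          exact Submodule.add_mem _
            (Submodule.smul_mem _ _ (XOP.mem_window (by omega) (by omega)))
            (XOP.map_band_le_window hPhatT (Submodule.mem_map_of_mem hg))
        · have hl : lam k ≠ 0 := fun h => hk (hlam (h.trans hlam0.symm))
          exact XOP.map_band_le_window hPhatT
            (XOP.mul_raise_mem_map hGa hA2 hB.le hP' hX hIj hId.le hpj hl)
  · obtain ⟨J, E, m, hG1, hE0, hJ1, hGa, hη⟩ :=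
      XOP.exists_gauged_I_II hA hA2 hB.le hρ hIII hG
    have hode := fun n => XOP.lower_seed hGa hΩ hΩne hAΩ (fun x hx => hη x (hAΩ x hx)) hξ (hp n)
    have hGx : ∀ x ∈ Ω, G.eval x ≠ 0 := fun x hx h0 => hAΩ x hx (by simp [hGa.mul_eq, h0])
    have hdarb : ∀ (f : ℂ[X]), ∀ x ∈ Ω,
        XOP.darboux G ξ (XOP.quasi ξ (p j)) (fun y => f.eval y) x
          = (XOP.raise G E (p j) f).eval x := fun f x hx =>
      XOP.darboux_eq_raise (hGx x hx) (hη x (hAΩ x hx)) (hξ x hx).1 (hξ x hx).2 f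
    -- The seed of degree `0` is used here, not the chosen one: it tests the factor at every `k ≥
    -- 0`, whereas `p j` would only reach `k ≥ j`.
    have hne : ∀ k : ℕ, J.coeff 1 * k + m ≠ 0 := fun k => by
      have := left_ne_zero_of_mul (XOP.raise_coeff_ne_zero hGa hG1 hE0 hJ1 (hode 0) (hpdeg 0)
        (hPdeg k) (hP' k) (hlm k 0))
      rwa [zero_add] at this
    have hdeg : ∀ k : ℕ, (XOP.raise G E (p j) (P k)).degree = ((k + j : ℕ) : WithBot ℕ) := fun k => by
      refine XOP.degree_eq_of_coeff_ne_zero (XOP.natDegree_raise_le hG1 hE0 hpj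
        (natDegree_eq_of_degree_eq_some (hPdeg k)).le) ?_
      rw [add_comm]
      exact right_ne_zero_of_mul (XOP.raise_coeff_ne_zero hGa hG1 hE0 hJ1 (hode j) (hpdeg j)
        (hPdeg k) (hP' k) (hlm k j))
    set T := XOP.raise G E (p j)
    let Phat : ℤ → ℂ[X] := fun n => if 0 ≤ n then T (P n.toNat) else 0
    have hPhatT : ∀ k : ℕ, T (P k) = Phat (k + 0) := by
      intro k
      simp [Phat]
    have hdeg' : ∀ n : ℕ, (Phat n).degree = ((n + j : ℕ) : WithBot ℕ) := fun n => by
      have := hPhatT n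
      rw [add_zero] at this
      rw [← this, hdeg]
    refine ⟨Phat, fun n x hx => ?_, ?_, fun n hn => ?_⟩
    · have : XOP.xop ρ j (fun m => XOP.darboux G ξ (XOP.quasi ξ (p j)) (fun y => (P m).eval y)) n x
          = if 0 ≤ n then XOP.darboux G ξ (XOP.quasi ξ (p j)) (fun y => (P n.toNat).eval y) x
            else 0 := by
        cases ρ with
        | I => rfl
        | II => rfl
        | III => exact absurd rfl hIII
      rw [this]
      simp only [Phat]
      split_ifs with h0
      · exact (hdarb _ x hx).symm
      · rw [eval_zero]
    · cases ρ with
      | I => exact hdeg'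
      | II => exact hdeg'
      | III => exact absurd rfl hIII
    · have h1 : 0 ≤ n := by
        by_contra h1
        exact hn (by simp only [Phat, if_neg h1])
      obtain ⟨k, rfl⟩ : ∃ k : ℕ, n = k + 0 := ⟨n.toNat, by omega⟩
      rw [← hPhatT]
      obtain ⟨g, hg, hlow⟩ := XOP.exists_lower_eq_zero hGa hA2 hB.le hP' hX
        (natDegree_mul_le.trans (by omega)) hIj hId.le hpj (hode j) (fun n => hlm n j) k
      rw [sub_eq_zero.1 (XOP.eq_zero_of_lower_eq_zero hJ1 hne hlow)]
      exact XOP.map_band_le_window hPhatT (Submodule.mem_map_of_mem hg)
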